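/- Say that an ultrafilter $\mathcal U$ on $\omega$ is \emph{selective} if it is free and, for every partition $\{A_n : n\in\omega\}$ of $\omega$ into nonempty sets, either $A_n\in\mathcal U$ for some $n$, or there are points $a_n\in A_n$ ($n\in\omega$) such that $\{a_n : n\in\omega\}\in\mathcal U$. A \emph{Wallace semigroup} is a nonempty countably compact Hausdorff both-sided cancellative topological semigroup (a semigroup with jointly continuous multiplication) that is not a topological group. \textbf{Theorem.} If a selective ultrafilter on $\omega$ exists, then a Wallace semigroup exists. More precisely, let $\mathfrak c$ be the cardinality of the continuum, let $\mathbb Z^{(\mathfrak c)}$ be the free Abelian group of finitely supported functions $\mathfrak c\to\mathbb Z$, and let $\mathbb N^{(\mathfrak c)}\subseteq\mathbb Z^{(\mathfrak c)}$ be the subsemigroup of those functions all of whose values are non-negative. If a selective ultrafilter exists, then there is a countably compact Hausdorff group topology on $\mathbb Z^{(\mathfrak c)}$ such that $\mathbb N^{(\mathfrak c)}$, with the subspace topology, is a Wallace semigroup. -/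

import Mathlib

open Filter Set

/-- A free ultrafilter `U` on `ℕ` is *selective* if for every partition `(A n)` of `ℕ` into
nonempty sets, either some `A n` belongs to `U`, or there is a choice of points `a n ∈ A n`
with `{a n : n ∈ ℕ} ∈ U`. -/
structure IsSelective (U : Ultrafilter ℕ) : Prop where
  free : (U : Filter ℕ) ≤ cofinite
  selects : ∀ A : ℕ → Set ℕ, (∀ n, (A n).Nonempty) →
    (∀ m n, m ≠ n → Disjoint (A m) (A n)) → (⋃ n, A n) = univ →
    (∃ n, A n ∈ U) ∨ ∃ a : ℕ → ℕ, (∀ n, a n ∈ A n) ∧ range a ∈ U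

/-- A *Wallace semigroup*: a nonempty, Hausdorff, countably compact, both-sided cancellative
topological semigroup (the multiplication is jointly continuous) which is not a topological
group, that is, its multiplication is not that of a group whose operations are continuous. -/
structure IsWallaceSemigroup (S : Type*) [hS : Semigroup S] [hT : TopologicalSpace S] : Prop where
  nonempty : Nonempty S
  t2 : T2Space S
  continuousMul : ContinuousMul S
  countablyCompact : CountablyCompactSpace S
  cancel : IsCancelMul S
  not_topologicalGroup : ¬ ∃ G : Group S,
    G.toDivInvMonoid.toMonoid.toSemigroup = hS ∧ @IsTopologicalGroup S hT G

/-- `ℕ^(ι)` inside `ℤ^(ι)`: the finitely supported integer-valued functions on `ι` all of whose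
values are natural numbers (including zero). -/
def natFinsupp (ι : Type*) : AddSubmonoid (ι →₀ ℤ) where
  carrier := {f | ∀ i, 0 ≤ f i}
  zero_mem' := fun _ => le_refl 0
  add_mem' := fun hf hg i => add_nonneg (hf i) (hg i)

/-! The topology is the weakest one making a family `V` of homomorphisms into the circle continuous.
All injective sequences in the free group, at most continuum many, are listed along a well-order
whose proper initial segments have size below the continuum. Recursively, each is reindexed by an
injection so that no nontrivial integer combination of the resulting sequences is constant modulo
`U` (`exists_independent_reindexing`), and each is assigned a fresh generator as its limit
(`exists_fresh_index`). `V` consists of all homomorphisms respecting these limits along `U`, so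
convergence is built in; the real issue is that `V` separates points, i.e. that the topology is
Hausdorff.

For `c ≠ 0` a countable set `D` of indices, closed under occurrence of generators in supports, is
handled first. Under a random assignment from a box, finitely many independent sequences become
jointly equidistributed (Weyl's criterion and Riemann-Lebesgue), so they can be steered near any
targets from within any open set. Selectivity turns these approximations into a single assignment
realizing all the limits in `D` and not killing `c`. The remaining generators receive their values
by recursion, as `U`-limits in the compact circle (`exists_character`).

Every limit is a generator, hence lies in the non-negative cone. So the group and the cone are both
countably compact, while generators have no inverses in the cone. -/

/-! ### Selective ultrafilters: diagonal intersections and generic points -/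

/-- On a set of a selective ultrafilter every function on `ℕ` is constant or injective. -/
theorem IsSelective.const_or_injOn {U : Ultrafilter ℕ} (hU : IsSelective U) (f : ℕ → ℕ) :
    (∃ m, f ⁻¹' {m} ∈ U) ∨ ∃ A ∈ U, InjOn f A := by
  classical
  by_cases hfin : (range f).Finite
  · left
    have h : (⋃ m ∈ range f, f ⁻¹' {m}) ∈ U := by
      have : (⋃ m ∈ range f, f ⁻¹' {m}) = univ := by
        ext x; simp
      rw [this]; exact univ_mem
    obtain ⟨m, -, hm⟩ := (Ultrafilter.finite_biUnion_mem_iff hfin).1 h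
    exact ⟨m, hm⟩
  · have : Infinite (range f) := Set.infinite_coe_iff.2 hfin
    let : Denumerable (range f) := Denumerable.ofEncodableOfInfinite _
    let e : ℕ ≃ range f := (Denumerable.eqv _).symm
    have hne : ∀ n, (f ⁻¹' {(e n : ℕ)}).Nonempty := fun n => (e n).2
    have hdisj : ∀ m n, m ≠ n → Disjoint (f ⁻¹' {(e m : ℕ)}) (f ⁻¹' {(e n : ℕ)}) := by
      intro m n hmn
      refine Set.disjoint_left.2 fun x hx hy => hmn ?_
      have h1 : f x = e m := hx
      have h2 : f x = e n := hy
      exact e.injective (Subtype.ext (h1.symm.trans h2))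
    have hcover : (⋃ n, f ⁻¹' {(e n : ℕ)}) = univ := by
      refine eq_univ_of_forall fun x => mem_iUnion.2 ⟨e.symm ⟨f x, mem_range_self x⟩, ?_⟩
      simp
    rcases hU.selects _ hne hdisj hcover with ⟨n, hn⟩ | ⟨a, ha, hr⟩
    · exact Or.inl ⟨_, hn⟩
    · refine Or.inr ⟨_, hr, ?_⟩
      rintro _ ⟨m, rfl⟩ _ ⟨n, rfl⟩ h
      have h1 : f (a m) = e m := ha m
      have h2 : f (a n) = e n := ha n
      rw [h1, h2] at h
      rw [e.injective (Subtype.ext h)]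

theorem IsSelective.finite_notMem {U : Ultrafilter ℕ} (hU : IsSelective U) {s : Set ℕ}
    (hs : s.Finite) : s ∉ U := fun h => by
  have h1 : sᶜ ∈ U := hU.free hs.compl_mem_cofinite
  exact (U.compl_mem_iff_notMem.1 h1) h

/-- Diagonal intersections of selective ultrafilters. -/
theorem IsSelective.exists_diagonal {U : Ultrafilter ℕ} (hU : IsSelective U) (B : ℕ → Set ℕ)
    (hB : ∀ m, B m ∈ U) : ∃ A ∈ U, ∀ m ∈ A, ∀ n ∈ A, m < n → n ∈ B m := by
  classical
  let B' : ℕ → Set ℕ := fun m => B m ∩ Ioi m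
  have hB' : ∀ m, B' m ∈ U := fun m => inter_mem (hB m) (hU.free (by
    rw [mem_cofinite]; exact (finite_Iic m).subset fun x hx => by simpa using hx))
  have hex : ∀ n, ∃ m, n ∉ B' m := fun n => ⟨n, fun h => lt_irrefl n h.2⟩
  -- `f n` is the first index at which `n` drops out; intersecting with `Ioi m` guarantees that
  -- there is one. It remains to find a set of `U` on which `m < n` forces `m < f n`.
  let f : ℕ → ℕ := fun n => Nat.find (hex n)
  have hf : ∀ n, n ∉ B' (f n) := fun n => Nat.find_spec (hex n)
  have hf' : ∀ n m, m < f n → n ∈ B' m := fun n m h => not_not.1 (Nat.find_min (hex n) h)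
  obtain ⟨A, hA, hfA⟩ : ∃ A ∈ U, InjOn f A := by
    rcases hU.const_or_injOn f with ⟨m, hm⟩ | h
    · exfalso
      refine U.empty_notMem (mem_of_superset (inter_mem hm (hB' m)) ?_)
      rintro x ⟨hx, hx'⟩
      have : f x = m := hx
      exact hf x (this ▸ hx')
    · exact h
  have hfinite : ∀ p, ∃ b, ∀ n ∈ A, f n ≤ p → n < b := by
    intro p
    have : (A ∩ f ⁻¹' Iic p).Finite :=
      Set.Finite.of_finite_image ((finite_Iic p).subset (by rintro _ ⟨x, hx, rfl⟩; exact hx.2))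
        (hfA.mono inter_subset_left)
    obtain ⟨b, hb⟩ := this.bddAbove
    exact ⟨b + 1, fun n hn hnp => Nat.lt_succ_of_le (hb ⟨hn, hnp⟩)⟩
  choose g hg using hfinite
  -- The blocks `[e k, e (k + 1))` grow so fast that every `n ∈ A` with `e (k + 1) ≤ n` has `e k < f
  -- n`. Below, `K n` is the block of `n`.
  obtain ⟨e, e0, es⟩ : ∃ e : ℕ → ℕ, e 0 = 0 ∧ ∀ k, e (k + 1) = max (e k + 1) (g (e k)) :=
    ⟨fun k => Nat.rec 0 (fun _ x => max (x + 1) (g x)) k, rfl, fun _ => rfl⟩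
  have emono : StrictMono e := strictMono_nat_of_lt_succ fun k => by
    rw [es]; exact lt_of_lt_of_le (Nat.lt_succ_self _) (le_max_left _ _)
  let K : ℕ → ℕ := fun n => Nat.findGreatest (fun k => e k ≤ n) n
  have hK1 : ∀ n, e (K n) ≤ n := by
    intro n
    have h : e 0 ≤ n := by simp [e0]
    exact Nat.findGreatest_spec (P := fun k : ℕ => e k ≤ n) (Nat.zero_le n) h
  have hK2 : ∀ n, n < e (K n + 1) := by
    intro n
    by_contra h
    push Not at h
    have h1 : K n + 1 ≤ n := (emono.id_le _).trans h
    have h2 : K n + 1 ≤ K n := Nat.le_findGreatest h1 h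
    omega
  have hKmono : Monotone K := by
    intro m n h
    have : e (K m) < e (K n + 1) := (hK1 m).trans_lt (h.trans_lt (hK2 n))
    exact Nat.lt_succ_iff.1 (emono.lt_iff_lt.1 this)
  obtain ⟨A2, hA2, hKA⟩ : ∃ A ∈ U, InjOn K A := by
    rcases hU.const_or_injOn K with ⟨m, hm⟩ | h
    · exfalso
      refine hU.finite_notMem ((finite_Iio (e (m + 1))).subset ?_) hm
      intro x hx
      have : K x = m := hx
      exact this ▸ hK2 x
    · exact h
  -- With at most one point per block and all blocks of equal parity, a full block separates any two
  -- points, which is the room that the growth of `e` requires.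
  obtain ⟨A3, hA3, hpar⟩ : ∃ A ∈ U, ∀ m ∈ A, ∀ n ∈ A, K m % 2 = K n % 2 := by
    rcases U.mem_or_compl_mem {n | K n % 2 = 0} with h | h
    · exact ⟨_, h, fun m hm n hn => by simp_all⟩
    · refine ⟨_, h, fun m hm n hn => ?_⟩
      have h1 : K m % 2 ≠ 0 := hm
      have h2 : K n % 2 ≠ 0 := hn
      omega
  refine ⟨A ∩ A2 ∩ A3, inter_mem (inter_mem hA hA2) hA3, ?_⟩
  rintro m ⟨⟨hm, hm2⟩, hm3⟩ n ⟨⟨hn, hn2⟩, hn3⟩ hmn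
  have h1 := hKmono hmn.le
  have h2 : K m ≠ K n := fun h => hmn.ne (hKA hm2 hn2 h)
  have h3 := hpar m hm3 n hn3
  have h4 : K m + 2 ≤ K n := by omega
  have h5 : e (K m + 2) ≤ n := (emono.monotone h4).trans (hK1 n)
  have h6 : g (e (K m + 1)) ≤ n := (le_max_right _ _).trans ((es (K m + 1)).ge.trans h5)
  have h7 : e (K m + 1) < f n := by
    by_contra h
    push Not at h
    exact absurd (hg _ n hn h) (not_lt.2 h6)
  exact (hf' n m ((hK2 m).trans h7)).1

theorem IsSelective.exists_strictMono {U : Ultrafilter ℕ} (hU : IsSelective U) (B : ℕ → Set ℕ)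
    (hB : ∀ m, B m ∈ U) {C : Set ℕ} (hC : C ∈ U) :
    ∃ a : ℕ → ℕ, StrictMono a ∧ range a ∈ U ∧ a 0 ∈ C ∧ ∀ n, a (n + 1) ∈ B (a n) := by
  classical
  obtain ⟨A, hA, h⟩ := hU.exists_diagonal B hB
  have hAC := inter_mem hA hC
  have : Infinite ↥(A ∩ C) :=
    Set.infinite_coe_iff.2 fun hf => hU.finite_notMem hf hAC
  have hmem : ∀ n, Nat.orderEmbeddingOfSet (A ∩ C) n ∈ A ∩ C := fun n =>
    (Nat.orderEmbeddingOfSet_range (A ∩ C)).subset (mem_range_self n)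
  refine ⟨Nat.orderEmbeddingOfSet (A ∩ C), (Nat.orderEmbeddingOfSet _).strictMono, ?_,
    (hmem 0).2, fun n => h _ (hmem n).1 _ (hmem (n + 1)).1
      ((Nat.orderEmbeddingOfSet _).strictMono (Nat.lt_succ_self n))⟩
  rw [Nat.orderEmbeddingOfSet_range]; exact hAC

/-- If, for a decreasing sequence of families of open sets, every nonempty open set meets
`U`-almost all members of each family, then some point of any given nonempty open set lies, for
each family, in `U`-almost all members. -/
theorem IsSelective.exists_mem_generic {U : Ultrafilter ℕ} (hU : IsSelective U) {X : Type*}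
    [TopologicalSpace X] [CompactSpace X] [T2Space X] (O : ℕ → ℕ → Set X)
    (hO : ∀ n a, IsOpen (O n a)) (hanti : ∀ m n a, m ≤ n → O n a ⊆ O m a)
    (hdense : ∀ W : Set X, IsOpen W → W.Nonempty → ∀ n, {a | (W ∩ O n a).Nonempty} ∈ U)
    {W₀ : Set X} (hW₀ : IsOpen W₀) (hne : W₀.Nonempty) :
    ∃ x ∈ W₀, ∀ n, {a | x ∈ O n a} ∈ U := by
  classical
  let Y := {W : Set X // IsOpen W ∧ W.Nonempty}
  have hshrink : ∀ (W : Y) (n a : ℕ), ∃ V : Y,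
      (W.1 ∩ O n a).Nonempty → closure V.1 ⊆ W.1 ∩ O n a := by
    intro W n a
    by_cases h : (W.1 ∩ O n a).Nonempty
    · obtain ⟨x, hx⟩ := h
      obtain ⟨t, ht, htc, hts⟩ := exists_mem_nhds_isClosed_subset
        ((W.2.1.inter (hO n a)).mem_nhds hx)
      refine ⟨⟨interior t, isOpen_interior, ⟨x, mem_interior_iff_mem_nhds.2 ht⟩⟩, fun _ => ?_⟩
      exact (closure_minimal interior_subset htc).trans hts
    · exact ⟨W, fun h' => absurd h' h⟩
  choose R hR using hshrink
  -- `S m` contains every open set reachable by shrinking steps at places below `m`. It is finite,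
  -- so the next place can be required to suit all of them at once, before it is known which places
  -- will be used.
  let S : ℕ → Finset Y := fun m => Nat.rec {⟨W₀, hW₀, hne⟩}
    (fun m s => s ∪ (s ×ˢ Finset.range (m + 1)).image fun p => R p.1 p.2 m) m
  have hS0 : S 0 = {⟨W₀, hW₀, hne⟩} := rfl
  have hSs : ∀ m, S (m + 1) = S m ∪ (S m ×ˢ Finset.range (m + 1)).image fun p => R p.1 p.2 m :=
    fun m => rfl
  have hSmono : Monotone S := monotone_nat_of_le_succ fun m => by
    rw [hSs]; exact Finset.subset_union_left
  let B : ℕ → Set ℕ := fun m =>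
    ⋂ p ∈ (S (m + 1) ×ˢ Finset.range (m + 2) : Finset (Y × ℕ)), {a | (p.1.1 ∩ O p.2 a).Nonempty}
  have hB : ∀ m, B m ∈ U := fun m =>
    (biInter_finset_mem _).2 fun p _ => hdense p.1.1 p.1.2.1 p.1.2.2 p.2
  obtain ⟨a, ha, hra, ha0, has⟩ := hU.exists_strictMono B hB (hdense W₀ hW₀ hne 0)
  let W : ℕ → Y := fun n => Nat.rec ⟨W₀, hW₀, hne⟩ (fun n V => R V n (a n)) n
  have hWs : ∀ n, W (n + 1) = R (W n) n (a n) := fun n => rfl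
  have hWS : ∀ n, W n ∈ S (a n) := by
    intro n
    induction n with
    | zero => exact hSmono (Nat.zero_le _) (by rw [hS0]; exact Finset.mem_singleton_self _)
    | succ n ih =>
      refine hSmono (Nat.succ_le_of_lt (ha (Nat.lt_succ_self n))) ?_
      rw [hSs, hWs]
      refine Finset.mem_union_right _ (Finset.mem_image.2 ⟨(W n, n), ?_, rfl⟩)
      exact Finset.mem_product.2 ⟨ih, Finset.mem_range.2 (Nat.lt_succ_of_le (ha.id_le n))⟩
  have hne' : ∀ n, ((W n).1 ∩ O n (a n)).Nonempty := by
    intro n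
    cases n with
    | zero => exact ha0
    | succ n =>
      have := mem_iInter₂.1 (has n) (W (n + 1), n + 1) (Finset.mem_product.2 ⟨?_, ?_⟩)
      · exact this
      · change W (n + 1) ∈ _
        rw [hSs, hWs]
        refine Finset.mem_union_right _ (Finset.mem_image.2 ⟨(W n, n), ?_, rfl⟩)
        exact Finset.mem_product.2 ⟨hWS n, Finset.mem_range.2 (Nat.lt_succ_of_le (ha.id_le n))⟩
      · exact Finset.mem_range.2 (by have := ha.id_le n; simp only [id] at this; omega)
  have hsub : ∀ n, closure (W (n + 1)).1 ⊆ (W n).1 ∩ O n (a n) := fun n => by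
    rw [hWs]; exact hR _ _ _ (hne' n)
  obtain ⟨x, hx⟩ := IsCompact.nonempty_iInter_of_sequence_nonempty_isCompact_isClosed
    (fun n => closure (W (n + 1)).1)
    (fun n => (hsub (n + 1)).trans (inter_subset_left.trans subset_closure))
    (fun n => (W (n + 1)).2.2.closure) isClosed_closure.isCompact (fun _ => isClosed_closure)
  rw [mem_iInter] at hx
  refine ⟨x, (hsub 0 (hx 0)).1, fun n => ?_⟩
  -- From place `a n` on, the point lies in sets of stage at least `n`, and these decrease with the
  -- stage.
  have hcof : {k | a n ≤ k} ∈ U := hU.free (by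
    rw [mem_cofinite]; exact (finite_Iio (a n)).subset fun y hy => by simpa using hy)
  refine mem_of_superset (inter_mem hra hcof) ?_
  rintro _ ⟨⟨k, rfl⟩, hk⟩
  exact hanti n k _ (ha.le_iff_le.1 hk) (hsub k (hx k)).2

/-! ### Equidistribution of independent sequences on tori -/

open MeasureTheory in
theorem integral_mFourier_eq_zero {κ : Type*} [Fintype κ] {z : κ → ℤ} (hz : z ≠ 0) :
    ∫ x, UnitAddTorus.mFourier z x ∂Measure.pi (fun _ : κ => AddCircle.haarAddCircle) = 0 := by
  have h := (UnitAddTorus.orthonormal_mFourier (d := κ)).2 hz.symm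
  simp only [ContinuousMap.inner_toLp, UnitAddTorus.mFourier_zero, ContinuousMap.one_apply,
    map_one, mul_one] at h
  exact h

theorem ContinuousMap.integrable_of_compactSpace {X : Type*} [TopologicalSpace X] [CompactSpace X]
    [MeasurableSpace X] [OpensMeasurableSpace X] (b : C(X, ℂ)) (ν : MeasureTheory.Measure X)
    [MeasureTheory.IsFiniteMeasure ν] : MeasureTheory.Integrable b ν :=
  b.continuous.integrable_of_hasCompactSupport (HasCompactSupport.of_compactSpace _)

open MeasureTheory in
/-- Weyl's criterion on a torus of finite dimension. -/
theorem tendsto_integral_of_tendsto_mFourier {κ α : Type*} [Fintype κ] {l : Filter α}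
    (ν : α → Measure (UnitAddTorus κ)) [∀ a, IsProbabilityMeasure (ν a)]
    (h : ∀ z : κ → ℤ, z ≠ 0 → Tendsto (fun a => ∫ x, UnitAddTorus.mFourier z x ∂ν a) l (nhds 0))
    (b : C(UnitAddTorus κ, ℂ)) :
    Tendsto (fun a => ∫ x, b x ∂ν a) l (nhds (∫ x, b x ∂Measure.pi (fun _ : κ => AddCircle.haarAddCircle))) := by
  set H := Measure.pi (fun _ : κ => AddCircle.haarAddCircle (T := 1)) with hH
  have hspan : ∀ p ∈ Submodule.span ℂ (range (UnitAddTorus.mFourier (d := κ))),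
      Tendsto (fun a => ∫ x, p x ∂ν a) l (nhds (∫ x, p x ∂H)) := by
    intro p hp
    induction hp using Submodule.span_induction with
    | mem p hp =>
      obtain ⟨z, rfl⟩ := hp
      by_cases hz : z = 0
      · subst hz
        simpa [UnitAddTorus.mFourier_zero] using tendsto_const_nhds
      · rw [integral_mFourier_eq_zero hz]
        exact h z hz
    | zero => simpa using tendsto_const_nhds
    | add p q _ _ hp hq =>
      have h1 : ∀ (ν : Measure (UnitAddTorus κ)) [IsFiniteMeasure ν],
          ∫ x, (p + q) x ∂ν = ∫ x, p x ∂ν + ∫ x, q x ∂ν := fun ν _ =>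
        integral_add (p.integrable_of_compactSpace ν) (q.integrable_of_compactSpace ν)
      simp only [h1]
      exact hp.add hq
    | smul c p _ hp =>
      have h1 : ∀ (ν : Measure (UnitAddTorus κ)), ∫ x, (c • p) x ∂ν = c • ∫ x, p x ∂ν := fun ν =>
        integral_smul c _
      simp only [h1]
      exact hp.const_smul c
  have hb : b ∈ closure (Submodule.span ℂ (range (UnitAddTorus.mFourier (d := κ))) :
      Set C(UnitAddTorus κ, ℂ)) := by
    rw [← Submodule.topologicalClosure_coe, UnitAddTorus.span_mFourier_closure_eq_top]
    trivial
  have hest : ∀ (p : C(UnitAddTorus κ, ℂ)) (ν : Measure (UnitAddTorus κ)) [IsProbabilityMeasure ν],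
      dist (∫ x, b x ∂ν) (∫ x, p x ∂ν) ≤ dist b p := by
    intro p ν _
    rw [dist_eq_norm, ← integral_sub (b.integrable_of_compactSpace ν)
      (p.integrable_of_compactSpace ν), dist_eq_norm]
    refine (norm_integral_le_of_norm_le_const (C := ‖b - p‖)
      (ae_of_all _ fun x => (b - p).norm_coe_le_norm x)).trans ?_
    simp
  rw [Metric.tendsto_nhds]
  intro ε hε
  obtain ⟨p, hp, hbp⟩ := Metric.mem_closure_iff.1 hb (ε / 3) (by positivity)
  filter_upwards [Metric.tendsto_nhds.1 (hspan p hp) (ε / 3) (by positivity)] with a ha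
  have h1 := hest p (ν a)
  have h2 := hest p H
  rw [dist_comm] at h2
  have h3 := dist_triangle4 (∫ x, b x ∂ν a) (∫ x, p x ∂ν a) (∫ x, p x ∂H) (∫ x, b x ∂H)
  linarith

theorem AddCircle.toCircle_sum {α : Type*} (s : Finset α) (x : α → UnitAddCircle) :
    (AddCircle.toCircle (∑ i ∈ s, x i) : ℂ) = ∏ i ∈ s, (AddCircle.toCircle (x i) : ℂ) := by
  classical
  induction s using Finset.induction_on with
  | empty => simp
  | insert a s ha ih => rw [Finset.sum_insert ha, Finset.prod_insert ha, ← ih,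
      AddCircle.toCircle_add, Circle.coe_mul]

/-- A character of the torus at the values of an assignment is a product of characters in the
assigned values. -/
theorem mFourier_linearCombination {κ ι : Type*} [Fintype κ] (z : κ → ℤ) (g : κ → ι →₀ ℤ)
    (ψ : ι → UnitAddCircle) :
    UnitAddTorus.mFourier z (fun k => Finsupp.linearCombination ℤ ψ (g k)) =
      ∏ i ∈ (∑ k, z k • g k).support, fourier ((∑ k, z k • g k) i) (ψ i) := by
  have h1 : UnitAddTorus.mFourier z (fun k => Finsupp.linearCombination ℤ ψ (g k)) =
      (AddCircle.toCircle (Finsupp.linearCombination ℤ ψ (∑ k, z k • g k)) : ℂ) := by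
    rw [map_sum, AddCircle.toCircle_sum]
    simp only [map_smul]
    rfl
  rw [h1, Finsupp.linearCombination_apply, Finsupp.sum, AddCircle.toCircle_sum]
  rfl

open MeasureTheory unitInterval in
theorem integral_fourier_segment (n : ℤ) (hn : n ≠ 0) (x : UnitAddCircle) (d : ℝ) (hd : d ≠ 0) :
    ∫ s : I, fourier n (x + ((d * (s : ℝ) : ℝ) : UnitAddCircle)) =
      fourier n x * ((Complex.exp (2 * Real.pi * Complex.I * n * d) - 1) /
        (2 * Real.pi * Complex.I * n * d)) := by
  have hc : (2 * Real.pi * Complex.I * n * d : ℂ) ≠ 0 := by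
    have : (Real.pi : ℂ) ≠ 0 := by exact_mod_cast Real.pi_ne_zero
    have : (n : ℂ) ≠ 0 := by exact_mod_cast hn
    have : (d : ℂ) ≠ 0 := by exact_mod_cast hd
    simp_all [Complex.I_ne_zero]
  have h1 : ∀ s : I, fourier n (x + ((d * (s : ℝ) : ℝ) : UnitAddCircle)) =
      fourier n x * (fun t : ℝ => Complex.exp (2 * Real.pi * Complex.I * n * d * t)) s := by
    intro s
    rw [fourier_apply, smul_add, AddCircle.toCircle_add, Circle.coe_mul, ← fourier_apply,
      ← fourier_apply, fourier_coe_apply]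
    congr 2
    push_cast
    ring
  simp only [h1]
  rw [integral_const_mul]
  congr 1
  have h2 := measurableEmbedding_coe.integral_map (μ := volume)
    (fun t : ℝ => Complex.exp (2 * Real.pi * Complex.I * n * d * t))
  rw [measurePreserving_coe.map_eq] at h2
  rw [← h2, integral_Icc_eq_integral_Ioc, ← intervalIntegral.integral_of_le zero_le_one,
    integral_exp_mul_complex hc]
  simp

open MeasureTheory unitInterval in
theorem norm_integral_fourier_segment_le (n : ℤ) (hn : n ≠ 0) (x : UnitAddCircle) (d : ℝ)
    (hd : 0 < d) :
    ‖∫ s : I, fourier n (x + ((d * (s : ℝ) : ℝ) : UnitAddCircle))‖ ≤ 1 / (d * |(n : ℝ)|) := by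
  rw [integral_fourier_segment n hn x d hd.ne', norm_mul, norm_div]
  have h1 : ‖fourier n x‖ = 1 := by rw [fourier_apply]; exact Circle.norm_coe _
  have h2 : ‖Complex.exp (2 * Real.pi * Complex.I * n * d)‖ = 1 := by
    rw [show (2 * Real.pi * Complex.I * n * d : ℂ) =
      ((2 * Real.pi * n * d : ℝ) : ℂ) * Complex.I by push_cast; ring]
    exact Complex.norm_exp_ofReal_mul_I _
  have h3 : ‖Complex.exp (2 * Real.pi * Complex.I * n * d) - 1‖ ≤ 2 := by
    refine (norm_sub_le _ _).trans ?_
    rw [h2, norm_one]; norm_num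
  have h4 : ‖(2 * Real.pi * Complex.I * n * d : ℂ)‖ = 2 * Real.pi * (d * |(n : ℝ)|) := by
    simp [abs_of_pos Real.pi_pos, abs_of_pos hd]
    ring
  have h5 : 0 < d * |(n : ℝ)| := by positivity
  rw [h1, one_mul, h4, div_le_div_iff₀ (by positivity) h5]
  have : (2 : ℝ) ≤ 2 * Real.pi := by linarith [Real.pi_gt_three]
  nlinarith

-- At length one the segment goes once around the circle, over which a nontrivial character averages
-- to zero.
open MeasureTheory unitInterval in
theorem integral_fourier_circle (n : ℤ) (hn : n ≠ 0) (x : UnitAddCircle) :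
    ∫ s : I, fourier n (x + ((1 * (s : ℝ) : ℝ) : UnitAddCircle)) = 0 := by
  rw [integral_fourier_segment n hn x 1 one_ne_zero]
  have : Complex.exp (2 * Real.pi * Complex.I * n * (1 : ℝ)) = 1 := by
    rw [← Complex.exp_int_mul_two_pi_mul_I n]
    congr 1
    push_cast
    ring
  rw [this]
  simp

/-- The point obtained from `ψ` by moving the coordinate `i` by `d i * s i`. -/
noncomputable def segmentPoint {ι : Type*} (ψ : ι → UnitAddCircle) (d : ι → ℝ)
    (s : ι → unitInterval) (i : ι) : UnitAddCircle :=
  ψ i + ((d i * (s i : ℝ) : ℝ) : UnitAddCircle)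

open MeasureTheory unitInterval in
theorem integral_prod_fourier_segmentPoint {ι : Type*} (ψ : ι → UnitAddCircle) (d : ι → ℝ)
    (w : ι →₀ ℤ) :
    ∫ s, ∏ i ∈ w.support, fourier (w i) (segmentPoint ψ d s i)
        ∂Measure.infinitePi (fun _ : ι => (volume : Measure I)) =
      ∏ i ∈ w.support, ∫ s : I, fourier (w i) (ψ i + ((d i * (s : ℝ) : ℝ) : UnitAddCircle)) := by
  have hm : ∀ (n : ℤ) (x : UnitAddCircle) (r : ℝ), Continuous fun s : I =>
      fourier n (x + ((r * (s : ℝ) : ℝ) : UnitAddCircle)) := fun n x r =>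
    (fourier n).continuous.comp (continuous_const.add
      ((AddCircle.continuous_mk' (1 : ℝ)).comp (by fun_prop)))
  have h1 : ∀ s : ι → I, ∏ i ∈ w.support, fourier (w i) (segmentPoint ψ d s i) =
      (fun y : (i : w.support) → I => ∏ i : w.support,
        fourier (w i) (ψ i + ((d i * (y i : ℝ) : ℝ) : UnitAddCircle))) (w.support.restrict s) := by
    intro s
    rw [← Finset.prod_coe_sort]
    rfl
  have h2 : Continuous fun y : (i : w.support) → I => ∏ i : w.support,
      fourier (w i) (ψ i + ((d i * (y i : ℝ) : ℝ) : UnitAddCircle)) :=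
    continuous_finsetProd _ fun i _ => (hm _ _ _).comp (continuous_apply i)
  refine (integral_congr_ae (ae_of_all _ h1)).trans
    ((integral_restrict_infinitePi (μ := fun _ : ι => (volume : Measure I))
      h2.aestronglyMeasurable).trans ?_)
  rw [integral_fintype_prod_eq_prod
    (fun (i : w.support) (s : I) => fourier (w i) (ψ i + ((d i * (s : ℝ) : ℝ) : UnitAddCircle)))]
  exact Finset.prod_coe_sort w.support
    (fun i => ∫ s : I, fourier (w i) (ψ i + ((d i * (s : ℝ) : ℝ) : UnitAddCircle)))

open MeasureTheory unitInterval in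
/-- Riemann-Lebesgue for the uniform distribution on a box with finitely many proper sides. -/
theorem finite_norm_prod_integral_ge {ι : Type*} [DecidableEq ι] (ψ : ι → UnitAddCircle)
    (E : Finset ι) {δ : ℝ} (hδ : 0 < δ) {ε : ℝ} (hε : 0 < ε) :
    {w : ι →₀ ℤ | ε ≤ ‖∏ i ∈ w.support, ∫ s : I, fourier (w i)
      (ψ i + (((if i ∈ E then δ else 1) * (s : ℝ) : ℝ) : UnitAddCircle))‖}.Finite := by
  -- A factor with frequency `w i` on a side of length `δ` is at most `1 / (δ * |w i|)` and the
  -- others are at most 1, so a product of size at least `ε` forces `|w i| ≤ 1 / (δ * ε)`.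
  obtain ⟨N, hN⟩ := exists_nat_ge (1 / (δ * ε))
  refine (Finset.finite_toSet (E.finsupp fun _ => Finset.Icc (-(N : ℤ)) N)).subset ?_
  intro w hw
  have hw : ε ≤ ‖_‖ := hw
  rw [norm_prod] at hw
  have hsupp : w.support ⊆ E := by
    intro i hi
    by_contra hiE
    have h0 : ‖∫ s : I, fourier (w i)
        (ψ i + (((if i ∈ E then δ else 1) * (s : ℝ) : ℝ) : UnitAddCircle))‖ = 0 := by
      rw [if_neg hiE, integral_fourier_circle _ (Finsupp.mem_support_iff.1 hi), norm_zero]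
    rw [Finset.prod_eq_zero hi h0] at hw
    exact absurd hw (not_le.2 hε)
  rw [Finset.mem_coe, Finset.mem_finsupp_iff]
  refine ⟨hsupp, fun i hiE => ?_⟩
  by_cases hwi : w i = 0
  · rw [hwi]; simp
  have hi : i ∈ w.support := Finsupp.mem_support_iff.2 hwi
  have hle : ∀ j ∈ w.support.erase i, ‖∫ s : I, fourier (w j)
      (ψ j + (((if j ∈ E then δ else 1) * (s : ℝ) : ℝ) : UnitAddCircle))‖ ≤ 1 := by
    intro j _
    refine (norm_integral_le_of_norm_le_const (C := 1) (ae_of_all _ fun s => ?_)).trans ?_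
    · rw [fourier_apply, Circle.norm_coe]
    · simp
  have h1 : ε ≤ 1 / (δ * |(w i : ℝ)|) := by
    refine hw.trans ?_
    rw [← Finset.mul_prod_erase _ _ hi]
    have h2 := norm_integral_fourier_segment_le (w i) hwi (ψ i) δ hδ
    rw [if_pos hiE]
    refine (mul_le_of_le_one_right (norm_nonneg _) ?_).trans h2
    exact Finset.prod_le_one (fun _ _ => norm_nonneg _) hle
  have h3 : 0 < |(w i : ℝ)| := by positivity
  have h4 : |(w i : ℝ)| ≤ N := by
    refine le_trans ?_ hN
    rw [le_div_iff₀ (by positivity)] at h1 ⊢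
    linarith
  have h5 : |w i| ≤ (N : ℤ) := by exact_mod_cast h4
  exact Finset.mem_Icc.2 (abs_le.1 h5)

open MeasureTheory unitInterval in
theorem measurable_linearCombination_segmentPoint {ι : Type*} (ψ : ι → UnitAddCircle) (d : ι → ℝ)
    (g : ι →₀ ℤ) : Measurable fun s => Finsupp.linearCombination ℤ (segmentPoint ψ d s) g := by
  simp only [Finsupp.linearCombination_apply, Finsupp.sum, segmentPoint]
  refine Finset.measurable_fun_sum _ fun i _ => ?_
  have h : Continuous fun t : I => g i • (ψ i + ((d i * (t : ℝ) : ℝ) : UnitAddCircle)) :=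
    (continuous_zsmul (g i)).comp (continuous_const.add
      ((AddCircle.continuous_mk' (1 : ℝ)).comp (by fun_prop)))
  exact h.measurable.comp (measurable_pi_apply i)

open MeasureTheory unitInterval in
/-- If no nontrivial integer combination of the sequences `f · k` takes a value frequently, then
assignments from a fixed open set send the vectors `f a` close to any prescribed target. -/
theorem eventually_exists_linearCombination_near {ι κ α : Type*} [Fintype κ] {l : Filter α}
    (f : α → κ → ι →₀ ℤ)
    (hf : ∀ z : κ → ℤ, z ≠ 0 → ∀ c, ∀ᶠ a in l, ∑ k, z k • f a k ≠ c)
    {W : Set (ι → UnitAddCircle)} (hW : IsOpen W) (hne : W.Nonempty) (t : κ → UnitAddCircle)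
    {ε : ℝ} (hε : 0 < ε) :
    ∀ᶠ a in l, ∃ ψ ∈ W, ∀ k, dist (Finsupp.linearCombination ℤ ψ (f a k)) (t k) < ε := by
  classical
  obtain ⟨ψ, hψ⟩ := hne
  obtain ⟨E, u, hu, huW⟩ := isOpen_pi_iff.1 hW ψ hψ
  obtain ⟨δ, hδ, hδu⟩ : ∃ δ > 0, ∀ r : ℝ, 0 ≤ r → r ≤ δ → ∀ i ∈ E,
      ψ i + (r : UnitAddCircle) ∈ u i := by
    have h : ∀ᶠ r : ℝ in nhds 0, ∀ i ∈ E, ψ i + (r : UnitAddCircle) ∈ u i := by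
      refine (eventually_all_finset E).2 fun i hi => ?_
      have hc : Continuous fun r : ℝ => ψ i + (r : UnitAddCircle) :=
        continuous_const.add (AddCircle.continuous_mk' (1 : ℝ))
      exact hc.continuousAt.eventually_mem ((hu i hi).1.mem_nhds (by simpa using (hu i hi).2))
    obtain ⟨δ, hδ, h⟩ := Metric.eventually_nhds_iff.1 h
    refine ⟨δ / 2, by positivity, fun r h0 h1 => h ?_⟩
    rw [Real.dist_0_eq_abs, abs_of_nonneg h0]
    linarith
  -- Coordinates not restricted by the basic neighbourhood run over the whole circle, so any
  -- frequency there kills the integral.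
  let d : ι → ℝ := fun i => if i ∈ E then δ else 1
  let μ := Measure.infinitePi (fun _ : ι => (volume : Measure I))
  let M : α → (ι → I) → UnitAddTorus κ := fun a s k =>
    Finsupp.linearCombination ℤ (segmentPoint ψ d s) (f a k)
  have hM : ∀ a, Measurable (M a) := fun a =>
    measurable_pi_lambda _ fun k => measurable_linearCombination_segmentPoint ψ d (f a k)
  have hprob : ∀ a, IsProbabilityMeasure (μ.map (M a)) := fun a =>
    Measure.isProbabilityMeasure_map (hM a).aemeasurable
  have hint : ∀ (b : C(UnitAddTorus κ, ℂ)) a, ∫ x, b x ∂μ.map (M a) = ∫ s, b (M a s) ∂μ :=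
    fun b a => integral_map (hM a).aemeasurable b.continuous.aestronglyMeasurable
  have hweyl : ∀ z : κ → ℤ, z ≠ 0 →
      Tendsto (fun a => ∫ x, UnitAddTorus.mFourier z x ∂μ.map (M a)) l (nhds 0) := by
    intro z hz
    have h1 : ∀ a, ∫ x, UnitAddTorus.mFourier z x ∂μ.map (M a) =
        ∏ i ∈ (∑ k, z k • f a k).support, ∫ s : I, fourier ((∑ k, z k • f a k) i)
          (ψ i + ((d i * (s : ℝ) : ℝ) : UnitAddCircle)) := by
      intro a
      rw [hint, ← integral_prod_fourier_segmentPoint]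
      refine integral_congr_ae (ae_of_all _ fun s => ?_)
      exact mFourier_linearCombination z (f a) _
    rw [Metric.tendsto_nhds]
    intro η hη
    have hfin := finite_norm_prod_integral_ge ψ E hδ hη
    -- Only finitely many frequency vectors give a large integral, and by independence each is
    -- eventually avoided.
    have hev : ∀ᶠ a in l, ∀ w ∈ hfin.toFinset, ∑ k, z k • f a k ≠ w :=
      (eventually_all_finset _).2 fun w _ => hf z hz w
    filter_upwards [hev] with a ha
    rw [dist_zero_right, h1]
    by_contra hcon
    exact ha _ (hfin.mem_toFinset.2 (not_lt.1 hcon)) rfl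
  -- A bump supported near `t`: its Haar integral is positive, so eventually its integral under the
  -- image of the box measure is nonzero, and some point of the box lands near `t`.
  let b₀ : UnitAddTorus κ → ℝ := fun x => max 0 (ε - dist x t)
  have hb₀ : Continuous b₀ := by
    have : Continuous fun x : UnitAddTorus κ => dist x t := continuous_id.dist continuous_const
    exact continuous_const.max (continuous_const.sub this)
  let b : C(UnitAddTorus κ, ℂ) := ⟨fun x => (b₀ x : ℂ), Complex.continuous_ofReal.comp hb₀⟩
  have hbpos : ∫ x, b x ∂Measure.pi (fun _ : κ => AddCircle.haarAddCircle) ≠ 0 := by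
    have h1 : 0 < ∫ x, b₀ x ∂Measure.pi (fun _ : κ => AddCircle.haarAddCircle) := by
      refine hb₀.integral_pos_of_hasCompactSupport_nonneg_nonzero
        (HasCompactSupport.of_compactSpace _) (fun x => le_max_left _ _) (x := t) ?_
      simp only [b₀, dist_self, sub_zero]
      exact (lt_max_of_lt_right hε).ne'
    have h2 : ∫ x, b x ∂Measure.pi (fun _ : κ => AddCircle.haarAddCircle) =
        ((∫ x, b₀ x ∂Measure.pi (fun _ : κ => AddCircle.haarAddCircle) : ℝ) : ℂ) :=
      integral_ofReal
    rw [h2]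
    exact_mod_cast h1.ne'
  have hlim := tendsto_integral_of_tendsto_mFourier (fun a => μ.map (M a)) hweyl b
  filter_upwards [hlim.eventually_ne hbpos] with a ha
  rw [hint] at ha
  obtain ⟨s, hs⟩ : ∃ s, b (M a s) ≠ 0 := by
    by_contra! h
    exact ha (by simp [h])
  have hs0 : b₀ (M a s) ≠ 0 := fun h => hs (by
    change ((b₀ (M a s) : ℝ) : ℂ) = 0
    rw [h, Complex.ofReal_zero])
  have hdist : dist (M a s) t < ε := by
    by_contra h
    exact hs0 (max_eq_left (by linarith))
  refine ⟨segmentPoint ψ d s, huW fun i hi => ?_, fun k =>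
    (dist_le_pi_dist (M a s) t k).trans_lt hdist⟩
  have hi : i ∈ E := hi
  have hd : d i = δ := if_pos hi
  rw [segmentPoint, hd]
  exact hδu _ (mul_nonneg hδ.le (s i).2.1) (mul_le_of_le_one_right hδ.le (s i).2.2) i hi

/-! ### Homomorphisms to the circle with prescribed limits -/

/-- Recursion along a well-founded order, for choices restricted by the earlier choices. -/
theorem exists_of_local_choice {J X : Type*} [LinearOrder J] [WellFoundedLT J] [Nonempty X]
    (P : J → (J → X) → X → Prop) (hex : ∀ η F, ∃ x, P η F x)
    (hloc : ∀ η F F' x, (∀ η' < η, F η' = F' η') → P η F x → P η F' x) :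
    ∃ F : J → X, ∀ η, P η F (F η) := by
  classical
  choose G hG using hex
  -- The arbitrary value at later indices is harmless, since `hloc` makes the constraint depend only
  -- on earlier ones.
  let ext : (η : J) → ((η' : J) → η' < η → X) → J → X := fun η prev η' =>
    if h : η' < η then prev η' h else Classical.arbitrary X
  let F : J → X := (wellFounded_lt (α := J)).fix fun η prev => G η (ext η prev)
  have hF : ∀ η, F η = G η (ext η fun η' _ => F η') := fun η =>
    (wellFounded_lt (α := J)).fix_eq _ η
  refine ⟨F, fun η => ?_⟩
  rw [hF η]
  exact hloc η _ F _ (fun η' h => by simp [ext, h]) (hG η _)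

theorem exists_countable_closed {J : Type*} (N : J → Set J) (hN : ∀ η, (N η).Countable)
    {D₀ : Set J} (hD₀ : D₀.Countable) :
    ∃ D : Set J, D₀ ⊆ D ∧ D.Countable ∧ ∀ η ∈ D, N η ⊆ D := by
  let S : ℕ → Set J := fun n => Nat.rec D₀ (fun _ s => ⋃ η ∈ s, N η) n
  have hS : ∀ n, (S n).Countable := by
    intro n
    induction n with
    | zero => exact hD₀
    | succ n ih => exact ih.biUnion fun η _ => hN η
  refine ⟨⋃ n, S n, subset_iUnion S 0, countable_iUnion hS, fun η hη x hx => ?_⟩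
  obtain ⟨n, hn⟩ := mem_iUnion.1 hη
  exact mem_iUnion.2 ⟨n + 1, mem_biUnion hn hx⟩

/-- No nontrivial integer combination of the sequences `f η` is constant modulo `U`. -/
def IndependentModConst {ι J : Type*} (U : Ultrafilter ℕ) (f : J → ℕ → ι →₀ ℤ) : Prop :=
  ∀ z : J →₀ ℤ, z ≠ 0 → ∀ c, ∀ᶠ a in (U : Filter ℕ), (z.sum fun η n => n • f η a) ≠ c

theorem continuous_linearCombination_left {ι : Type*} (g : ι →₀ ℤ) :
    Continuous fun ψ : ι → UnitAddCircle => Finsupp.linearCombination ℤ ψ g := by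
  simp only [Finsupp.linearCombination_apply, Finsupp.sum]
  exact continuous_finsetSum _ fun i _ => (continuous_zsmul (g i)).comp (continuous_apply i)

theorem linearCombination_congr_of_eqOn_support {ι : Type*} {ψ ψ' : ι → UnitAddCircle}
    {g : ι →₀ ℤ} (h : ∀ i ∈ g.support, ψ i = ψ' i) :
    Finsupp.linearCombination ℤ ψ g = Finsupp.linearCombination ℤ ψ' g := by
  simp only [Finsupp.linearCombination_apply]
  exact Finsupp.sum_congr fun i hi => by rw [h i hi]

/-- Countably many independent sequences can be sent to sequences with prescribed limits. -/
theorem IsSelective.exists_tendsto_linearCombination {ι J : Type*} {U : Ultrafilter ℕ}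
    (hU : IsSelective U) {f : J → ℕ → ι →₀ ℤ} (hf : IndependentModConst U f) (m : J → ι)
    {D : Set J} (hD : D.Countable) {W₀ : Set (ι → UnitAddCircle)} (hW₀ : IsOpen W₀)
    (hne₀ : W₀.Nonempty) :
    ∃ ψ ∈ W₀, ∀ η ∈ D, Tendsto (fun a => Finsupp.linearCombination ℤ ψ (f η a)) U
      (nhds (ψ (m η))) := by
  classical
  rcases D.eq_empty_or_nonempty with rfl | hDne
  · obtain ⟨ψ, hψ⟩ := hne₀
    exact ⟨ψ, hψ, by simp⟩
  obtain ⟨e, rfl⟩ := hD.exists_eq_range hDne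
  let O : ℕ → ℕ → Set (ι → UnitAddCircle) := fun n a =>
    ⋂ k ∈ Finset.range (n + 1),
      {ψ | dist (Finsupp.linearCombination ℤ ψ (f (e k) a)) (ψ (m (e k))) < 1 / ((n : ℝ) + 1)}
  have hO : ∀ n a, IsOpen (O n a) := fun n a => isOpen_biInter_finset fun k _ =>
    isOpen_lt ((continuous_linearCombination_left _).dist (continuous_apply _)) continuous_const
  have hanti : ∀ p n a, p ≤ n → O n a ⊆ O p a := by
    intro p n a hpn ψ hψ
    simp only [O, mem_iInter, Finset.mem_range, mem_ofPred_eq] at hψ ⊢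
    intro k hk
    refine (hψ k (by omega)).trans_le (one_div_le_one_div_of_le (by positivity) ?_)
    exact_mod_cast Nat.succ_le_succ hpn
  have hdense : ∀ W : Set (ι → UnitAddCircle), IsOpen W → W.Nonempty → ∀ n,
      {a | (W ∩ O n a).Nonempty} ∈ U := by
    intro W hW ⟨ψ₀, hψ₀⟩ n
    let ε : ℝ := 1 / ((n : ℝ) + 1)
    have hε : 0 < ε := by positivity
    let F : Finset J := (Finset.range (n + 1)).image e
    -- The target `ψ (m η)` moves with `ψ`; on `V` it stays within `ε / 2` of a fixed point, which
    -- can then serve as the target.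
    let V : Set (ι → UnitAddCircle) := W ∩ ⋂ η ∈ F, {ψ | dist (ψ (m η)) (ψ₀ (m η)) < ε / 2}
    have hV : IsOpen V := hW.inter (isOpen_biInter_finset fun η _ =>
      isOpen_lt ((continuous_apply _).dist continuous_const) continuous_const)
    have hVne : V.Nonempty := ⟨ψ₀, hψ₀, by simp [hε]⟩
    have hind : ∀ z : F → ℤ, z ≠ 0 → ∀ c, ∀ᶠ a in (U : Filter ℕ),
        ∑ k, z k • f (k : J) a ≠ c := by
      intro z hz c
      have hz' : (Finsupp.equivFunOnFinite.symm z).mapDomain (Subtype.val : F → J) ≠ 0 := by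
        intro h
        have h1 := Finsupp.mapDomain_injective Subtype.val_injective
          (h.trans Finsupp.mapDomain_zero.symm)
        exact hz (funext fun k => DFunLike.congr_fun h1 k)
      filter_upwards [hf _ hz' c] with a ha
      rw [Finsupp.sum_mapDomain_index (by simp) (by intros; rw [add_smul]),
        Finsupp.sum_fintype _ _ (by simp)] at ha
      exact ha
    refine mem_of_superset (eventually_exists_linearCombination_near
      (fun a (k : F) => f (k : J) a) hind hV hVne (fun k => ψ₀ (m k)) (half_pos hε)) ?_
    rintro a ⟨ψ, ⟨hψW, hψV⟩, hψ⟩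
    refine ⟨ψ, hψW, ?_⟩
    simp only [O, mem_iInter, mem_ofPred_eq] at hψV ⊢
    intro k hk
    have hkF : e k ∈ F := Finset.mem_image_of_mem e hk
    have h1 := hψ ⟨e k, hkF⟩
    have h2 := hψV (e k) hkF
    rw [dist_comm] at h2
    have h3 := dist_triangle (Finsupp.linearCombination ℤ ψ (f (e k) a)) (ψ₀ (m (e k)))
      (ψ (m (e k)))
    have h4 : ε / 2 + ε / 2 = 1 / ((n : ℝ) + 1) := add_halves _
    linarith
  obtain ⟨ψ, hψ, h⟩ := hU.exists_mem_generic O hO hanti hdense hW₀ hne₀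
  refine ⟨ψ, hψ, ?_⟩
  rintro _ ⟨k, rfl⟩
  rw [Metric.tendsto_nhds]
  intro ε hε
  obtain ⟨p, hp⟩ := exists_nat_one_div_lt hε
  -- Stage `max p k` has tolerance below `ε` and already includes the `k`-th sequence.
  refine mem_of_superset (h (max p k)) fun a ha => ?_
  have h1 := mem_iInter₂.1 ha k (Finset.mem_range.2 (Nat.lt_succ_of_le (le_max_right _ _)))
  refine lt_trans (lt_of_lt_of_le h1 (one_div_le_one_div_of_le (by positivity) ?_)) hp
  have : (p : ℝ) ≤ ((max p k : ℕ) : ℝ) := by exact_mod_cast le_max_left p k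
  linarith

theorem exists_linearCombination_ne_zero {ι : Type*} {c : ι →₀ ℤ} (hc : c ≠ 0) :
    ∃ ψ : ι → UnitAddCircle, Finsupp.linearCombination ℤ ψ c ≠ 0 := by
  classical
  obtain ⟨i, hi⟩ := Finsupp.ne_iff.1 hc
  have hi : c i ≠ 0 := hi
  -- This assignment sends `c` to `1 / 2`, which is nonzero in the circle.
  refine ⟨Pi.single i ((1 / (2 * (c i : ℝ)) : ℝ) : UnitAddCircle), ?_⟩
  have h1 : Finsupp.linearCombination ℤ
      (Pi.single i ((1 / (2 * (c i : ℝ)) : ℝ) : UnitAddCircle)) c = ((1 / 2 : ℝ) : UnitAddCircle) := by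
    rw [Finsupp.linearCombination_apply, Finsupp.sum_eq_single i]
    · rw [Pi.single_eq_same, ← AddCircle.coe_zsmul]
      congr 1
      have : (c i : ℝ) ≠ 0 := by exact_mod_cast hi
      rw [zsmul_eq_mul]
      field_simp
    · intro j _ hj
      rw [Pi.single_eq_of_ne hj, smul_zero]
    · simp
  rw [h1]
  intro h
  obtain ⟨n, hn⟩ := (AddCircle.coe_eq_zero_iff (1 : ℝ)).1 h
  have h2 : (n : ℝ) = 1 / 2 := by simpa using hn
  have h3 : ((2 * n : ℤ) : ℝ) = ((1 : ℤ) : ℝ) := by push_cast; rw [h2]; norm_num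
  have h4 : 2 * n = 1 := by exact_mod_cast h3
  omega

/-- Independent sequences whose indices are placed above their supports are made convergent
by enough characters to separate the points. -/
theorem IsSelective.exists_character {ι J : Type*} [LinearOrder J] [WellFoundedLT J]
    {U : Ultrafilter ℕ} (hU : IsSelective U) {f : J → ℕ → ι →₀ ℤ} (hf : IndependentModConst U f)
    {m : J → ι} (hm : Function.Injective m)
    (hsupp : ∀ η a η', m η' ∈ (f η a).support → η' < η) {c : ι →₀ ℤ} (hc : c ≠ 0) :
    ∃ v : ι → UnitAddCircle, Finsupp.linearCombination ℤ v c ≠ 0 ∧ ∀ η,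
      Tendsto (fun a => Finsupp.linearCombination ℤ v (f η a)) U (nhds (v (m η))) := by
  classical
  have hpre : ∀ g : ι →₀ ℤ, {η | m η ∈ g.support}.Countable := fun g =>
    (g.support.finite_toSet.preimage hm.injOn).countable
  -- Closure of `D` means that the values on `c` and on the sequences indexed by `D` do not change
  -- when generators `m η` with `η ∉ D` are reassigned.
  obtain ⟨D, hD₀, hD, hDcl⟩ := exists_countable_closed
    (fun η => ⋃ a, {η' | m η' ∈ (f η a).support}) (fun η => countable_iUnion fun a => hpre _)
    (hpre c)
  obtain ⟨ψ, hψc, hψ⟩ := hU.exists_tendsto_linearCombination hf m hD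
    (W₀ := {ψ | Finsupp.linearCombination ℤ ψ c ≠ 0})
    (isOpen_ne_fun (continuous_linearCombination_left c) continuous_const)
    (exists_linearCombination_ne_zero hc)
  -- On `D` the values of `ψ` are kept; elsewhere compactness supplies the limit. By `hsupp` the
  -- sequence `f η` involves only generators `m η'` with `η' < η`, so the recursion is legitimate.
  obtain ⟨F, hF⟩ := exists_of_local_choice
    (fun (η : J) (F : J → UnitAddCircle) x => (η ∈ D → x = ψ (m η)) ∧ (η ∉ D →
      Tendsto (fun a => Finsupp.linearCombination ℤ (Function.extend m F ψ) (f η a)) U (nhds x)))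
    (by
      intro η F
      by_cases hη : η ∈ D
      · exact ⟨ψ (m η), fun _ => rfl, fun h => absurd hη h⟩
      · obtain ⟨x, -, hx⟩ := isCompact_univ.ultrafilter_le_nhds
          (U.map fun a => Finsupp.linearCombination ℤ (Function.extend m F ψ) (f η a)) (by simp)
        exact ⟨x, fun h => absurd h hη, fun _ => hx⟩)
    (by
      intro η F F' x h hx
      refine ⟨hx.1, fun hη => (hx.2 hη).congr fun a => ?_⟩
      refine linearCombination_congr_of_eqOn_support fun i hi => ?_
      by_cases hi' : ∃ η', m η' = i
      · obtain ⟨η', rfl⟩ := hi'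
        rw [hm.extend_apply, hm.extend_apply, h η' (hsupp η a η' hi)]
      · rw [Function.extend_apply' _ _ _ hi', Function.extend_apply' _ _ _ hi'])
  have hagree : ∀ i, (∀ η, m η = i → η ∈ D) → Function.extend m F ψ i = ψ i := by
    intro i hi
    by_cases hi' : ∃ η', m η' = i
    · obtain ⟨η', rfl⟩ := hi'
      rw [hm.extend_apply, (hF η').1 (hi η' rfl)]
    · rw [Function.extend_apply' _ _ _ hi']
  refine ⟨Function.extend m F ψ, ?_, fun η => ?_⟩
  · rw [linearCombination_congr_of_eqOn_support (ψ' := ψ) fun i hi => hagree i ?_]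
    · exact hψc
    · rintro η rfl
      exact hD₀ hi
  · rw [hm.extend_apply]
    by_cases hη : η ∈ D
    · rw [(hF η).1 hη]
      refine (hψ η hη).congr fun a => (linearCombination_congr_of_eqOn_support fun i hi => ?_).symm
      refine hagree i ?_
      rintro η' rfl
      exact hDcl η hη (mem_iUnion.2 ⟨a, hi⟩)
    · exact (hF η).2 hη

/-! ### Independent reindexings and fresh generators, by counting -/

theorem mk_finsupp_int_le {α : Type*} :
    Cardinal.mk (α →₀ ℤ) ≤ max (Cardinal.mk α) Cardinal.aleph0 := by
  cases isEmpty_or_nonempty α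
  · rw [Cardinal.mk_eq_one]
    exact Cardinal.one_le_aleph0.trans (le_max_right _ _)
  · simp

/-- A family of injections of `ℕ`, indexed by `ℕ → Bool`, any two of which agree only on a
finite set. -/
def branchCode (x : ℕ → Bool) (n : ℕ) : ℕ :=
  Encodable.encode ((List.range n).map x)

theorem branchCode_injective (x : ℕ → Bool) : Function.Injective (branchCode x) := by
  intro m n h
  have h1 := Encodable.encode_injective h
  simpa using congrArg List.length h1

/-- A prefix long enough to contain a coordinate where `x` and `y` differ has a different code. -/
theorem finite_branchCode_eq {x y : ℕ → Bool} (hxy : x ≠ y) :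
    {n | branchCode x n = branchCode y n}.Finite := by
  obtain ⟨k, hk⟩ := Function.ne_iff.1 hxy
  refine (finite_Iic k).subset fun n hn => ?_
  by_contra h
  have h1 := Encodable.encode_injective hn
  exact hk (List.map_inj_left.1 h1 k (List.mem_range.2 (by simpa using h)))

/-- Given fewer than continuum many sequences, an injective sequence has a reindexing by an
injection that is independent of them modulo constants. -/
theorem exists_reindexing {ι J : Type*} {U : Ultrafilter ℕ} (hU : (U : Filter ℕ) ≤ cofinite)
    {s : Set J} (hs : Cardinal.mk s < Cardinal.continuum) (f : J → ℕ → ι →₀ ℤ)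
    {g : ℕ → ι →₀ ℤ} (hg : Function.Injective g) :
    ∃ h : ℕ → ℕ, Function.Injective h ∧ ∀ z : J →₀ ℤ, (∀ η ∈ z.support, η ∈ s) →
      ∀ n : ℤ, n ≠ 0 → ∀ c, ∀ᶠ a in (U : Filter ℕ),
        n • g (h a) + (z.sum fun η k => k • f η a) ≠ c := by
  classical
  by_contra! hcon
  have hcon' : ∀ x : ℕ → Bool, ∃ z : J →₀ ℤ, (∀ η ∈ z.support, η ∈ s) ∧ ∃ n : ℤ, n ≠ 0 ∧
      ∃ c, ∀ᶠ a in (U : Filter ℕ),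
        n • g (branchCode x a) + (z.sum fun η k => k • f η a) = c := by
    intro x
    obtain ⟨z, hz, n, hn, c, hc⟩ := hcon (branchCode x) (branchCode_injective x)
    exact ⟨z, hz, n, hn, c, hc⟩
  choose z hz n hn c hc using hcon'
  let D : Set ι := ⋃ a, ((g a).support : Set ι)
  have hD : D.Countable := countable_iUnion fun a => (g a).support.finite_toSet.countable
  have hgD : ∀ a i, i ∉ D → g a i = 0 := fun a i hi => by
    by_contra h
    exact hi (mem_iUnion.2 ⟨a, Finset.mem_coe.2 (Finsupp.mem_support_iff.2 h)⟩)
  have : Countable D := hD.to_subtype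
  -- If every branch fails, each yields a relation. Recording the constant only on the countable set
  -- `D` that carries `g` leaves fewer than continuum many possibilities, so two branches share a
  -- record. Comparing their relations gives `g (branchCode x a) = g (branchCode y a)` for
  -- `U`-almost all `a`, although the two codes almost never agree.
  let Φ : (ℕ → Bool) → (ℤ × (D →₀ ℤ)) × (s →₀ ℤ) := fun x =>
    ((n x, (c x).subtypeDomain (· ∈ D)), (z x).subtypeDomain (· ∈ s))
  have hΦ : ¬ Function.Injective Φ := by
    intro hinj
    have h1 := Cardinal.lift_mk_le_lift_mk_of_injective hinj
    have h2 : Cardinal.mk ((ℤ × (D →₀ ℤ)) × (s →₀ ℤ)) < Cardinal.continuum := by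
      rw [Cardinal.mk_prod]
      refine Cardinal.mul_lt_of_lt Cardinal.aleph0_le_continuum ?_ ?_
      · rw [Cardinal.lift_lt_continuum]
        exact (Cardinal.mk_le_aleph0).trans_lt Cardinal.aleph0_lt_continuum
      · rw [Cardinal.lift_lt_continuum]
        exact mk_finsupp_int_le.trans_lt (max_lt hs Cardinal.aleph0_lt_continuum)
    have h3 : Cardinal.mk (ℕ → Bool) = Cardinal.continuum := by simp
    rw [h3, Cardinal.lift_continuum] at h1
    exact absurd (Cardinal.continuum_le_lift.1 h1) (not_le.2 h2)
  rw [Function.Injective] at hΦ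
  push Not at hΦ
  obtain ⟨x, y, hxy, hne⟩ := hΦ
  have hn' : n x = n y := congrArg (fun p => p.1.1) hxy
  have hc' : (c x).subtypeDomain (· ∈ D) = (c y).subtypeDomain (· ∈ D) :=
    congrArg (fun p => p.1.2) hxy
  have hz' : (z x).subtypeDomain (· ∈ s) = (z y).subtypeDomain (· ∈ s) :=
    congrArg (fun p => p.2) hxy
  have hzz : z x = z y := by
    ext η
    by_cases hη : η ∈ s
    · exact DFunLike.congr_fun hz' ⟨η, hη⟩
    · rw [Finsupp.notMem_support_iff.1 fun h => hη (hz x η h),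
        Finsupp.notMem_support_iff.1 fun h => hη (hz y η h)]
  have hcof : {a | branchCode x a ≠ branchCode y a} ∈ (U : Filter ℕ) :=
    hU (by
      rw [mem_cofinite]
      exact (finite_branchCode_eq hne).subset fun a ha => by simpa using ha)
  obtain ⟨a, ⟨hax, hay⟩, hna⟩ := U.nonempty_of_mem (inter_mem (inter_mem (hc x) (hc y)) hcof)
  refine hna (hg (Finsupp.ext fun i => ?_))
  by_cases hi : i ∈ D
  · have h1 : c x i = c y i := DFunLike.congr_fun hc' ⟨i, hi⟩
    rw [← show _ = c x from hax, ← show _ = c y from hay, hzz, hn', Finsupp.add_apply,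
      Finsupp.add_apply, add_left_inj, Finsupp.smul_apply, Finsupp.smul_apply] at h1
    exact mul_left_cancel₀ (hn y) h1
  · rw [hgD _ i hi, hgD _ i hi]

/-- Injective sequences indexed by a well-order with small initial segments have independent
reindexings. -/
theorem exists_independent_reindexing {ι J : Type*} [LinearOrder J] [WellFoundedLT J]
    {U : Ultrafilter ℕ} (hU : (U : Filter ℕ) ≤ cofinite)
    (hJ : ∀ η : J, Cardinal.mk (Iio η) < Cardinal.continuum) (g : J → ℕ → ι →₀ ℤ)
    (hg : ∀ η, Function.Injective (g η)) :
    ∃ h : J → ℕ → ℕ, (∀ η, Function.Injective (h η)) ∧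
      IndependentModConst U fun η a => g η (h η a) := by
  classical
  obtain ⟨h, hh⟩ := exists_of_local_choice
    (fun (η : J) (F : J → ℕ → ℕ) x => Function.Injective x ∧
      ∀ z : J →₀ ℤ, (∀ η' ∈ z.support, η' ∈ Iio η) → ∀ n : ℤ, n ≠ 0 → ∀ c,
        ∀ᶠ a in (U : Filter ℕ), n • g η (x a) + (z.sum fun η' k => k • g η' (F η' a)) ≠ c)
    (fun η F => exists_reindexing hU (hJ η) (fun η' a => g η' (F η' a)) (hg η))
    (by
      intro η F F' x hFF hx
      refine ⟨hx.1, fun z hz n hn c => ?_⟩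
      have h1 : ∀ a, (z.sum fun η' k => k • g η' (F' η' a)) =
          z.sum fun η' k => k • g η' (F η' a) := fun a =>
        Finsupp.sum_congr fun η' hη' => by rw [hFF η' (hz η' hη')]
      simp only [h1]
      exact hx.2 z hz n hn c)
  refine ⟨h, fun η => (hh η).1, fun z hz c => ?_⟩
  have hne : z.support.Nonempty := Finsupp.support_nonempty_iff.2 hz
  -- The reindexing at the largest index of `z` was chosen against all combinations of earlier ones.
  let η := z.support.max' hne
  have hη : η ∈ z.support := z.support.max'_mem hne
  have h1 := (hh η).2 (z.erase η) (by
    intro η' hη'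
    rw [Finsupp.support_erase, Finset.mem_erase] at hη'
    exact lt_of_le_of_ne (z.support.le_max' _ hη'.2) hη'.1) (z η)
    (Finsupp.mem_support_iff.1 hη) c
  filter_upwards [h1] with a ha
  rwa [← Finsupp.add_sum_erase z η _ hη]

/-- Fresh indices for the members of a family of sequences. -/
theorem exists_fresh_index {ι J : Type*} [LinearOrder J] [WellFoundedLT J]
    (hι : Cardinal.mk ι = Cardinal.continuum)
    (hJ : ∀ η : J, Cardinal.mk (Iio η) < Cardinal.continuum) (g : J → ℕ → ι →₀ ℤ) :
    ∃ m : J → ι, Function.Injective m ∧ ∀ η a η', m η' ∈ (g η a).support → η' < η := by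
  classical
  have : Nonempty ι := Cardinal.mk_ne_zero_iff.1 (by rw [hι]; exact Cardinal.continuum_ne_zero)
  -- The new index avoids all earlier choices and the supports of the current and all earlier
  -- sequences; together these sets have size below the continuum.
  obtain ⟨m, hm⟩ := exists_of_local_choice
    (fun (η : J) (F : J → ι) x => x ∉ F '' Iio η ∪
      ((⋃ p : Iio η × ℕ, ((g p.1 p.2).support : Set ι)) ∪ ⋃ a, ((g η a).support : Set ι)))
    (by
      intro η F
      have h1 : Cardinal.lift (Cardinal.mk (F '' Iio η)) < Cardinal.continuum :=
        Cardinal.mk_image_le_lift.trans_lt (Cardinal.lift_lt_continuum.2 (hJ η))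
      have h2 : Cardinal.lift (Cardinal.mk
          (⋃ p : Iio η × ℕ, ((g p.1 p.2).support : Set ι))) < Cardinal.continuum := by
        refine (Cardinal.mk_iUnion_le_lift _).trans_lt ?_
        refine Cardinal.mul_lt_of_lt Cardinal.aleph0_le_continuum ?_ ?_
        · rw [Cardinal.lift_lt_continuum, Cardinal.mk_prod]
          refine Cardinal.mul_lt_of_lt Cardinal.aleph0_le_continuum
            (Cardinal.lift_lt_continuum.2 (hJ η)) ?_
          rw [Cardinal.mk_nat, Cardinal.lift_aleph0]
          exact Cardinal.aleph0_lt_continuum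
        · refine lt_of_le_of_lt (ciSup_le' fun p => ?_) Cardinal.aleph0_lt_continuum
          rw [Cardinal.lift_le_aleph0]
          exact (Finset.finite_toSet _).countable.le_aleph0
      have h3 : Cardinal.mk (⋃ a, ((g η a).support : Set ι)) < Cardinal.continuum :=
        (countable_iUnion fun a => (g η a).support.finite_toSet.countable).le_aleph0.trans_lt
          Cardinal.aleph0_lt_continuum
      rw [Cardinal.lift_lt_continuum] at h1 h2
      by_contra! hcon
      have h4 := (Cardinal.mk_union_le (F '' Iio η)
        ((⋃ p : Iio η × ℕ, ((g p.1 p.2).support : Set ι)) ∪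
          ⋃ a, ((g η a).support : Set ι))).trans_lt
        (Cardinal.add_lt_of_lt Cardinal.aleph0_le_continuum h1
          ((Cardinal.mk_union_le _ _).trans_lt
            (Cardinal.add_lt_of_lt Cardinal.aleph0_le_continuum h2 h3)))
      rw [eq_univ_of_forall hcon, Cardinal.mk_univ, hι] at h4
      exact lt_irrefl _ h4)
    (by
      intro η F F' x h hx
      have himage : F' '' Iio η = F '' Iio η := image_congr fun η' hη' => (h η' hη').symm
      rwa [himage])
  refine ⟨m, ?_, ?_⟩
  · have hlt : ∀ η η', η < η' → m η ≠ m η' := fun η η' h he =>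
      hm η' (Or.inl ⟨η, h, he⟩)
    intro η η' he
    by_contra hne
    rcases lt_or_gt_of_ne hne with h | h
    · exact hlt _ _ h he
    · exact hlt _ _ h he.symm
  · intro η a η' h
    by_contra hle
    rcases (not_lt.1 hle).eq_or_lt with rfl | hlt
    · exact hm η (Or.inr (Or.inr (mem_iUnion.2 ⟨a, h⟩)))
    · exact hm η' (Or.inr (Or.inl (mem_iUnion.2 ⟨(⟨η, hlt⟩, a), h⟩)))

/-! ### The group topology, countable compactness and the Wallace semigroup -/

/-- From a selective ultrafilter one gets a Hausdorff group topology on the free Abelian group on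
`ι` in which every injective sequence has a reindexing converging to a generator. -/
theorem IsSelective.exists_addGroup_topology {U : Ultrafilter ℕ} (hU : IsSelective U) {ι : Type*}
    (hι : Cardinal.mk ι = Cardinal.continuum) :
    ∃ _ : TopologicalSpace (ι →₀ ℤ), IsTopologicalAddGroup (ι →₀ ℤ) ∧ T2Space (ι →₀ ℤ) ∧
      ∀ g : ℕ → ι →₀ ℤ, Function.Injective g → ∃ h : ℕ → ℕ, Function.Injective h ∧ ∃ i,
        Tendsto (fun a => g (h a)) U (nhds (Finsupp.single i 1)) := by
  classical
  have : Nonempty ι := Cardinal.mk_ne_zero_iff.1 (by rw [hι]; exact Cardinal.continuum_ne_zero)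
  obtain ⟨J, hJ, G, hG, hGsurj⟩ : ∃ (J : Type _), Cardinal.mk J ≤ Cardinal.continuum ∧
      ∃ G : J → ℕ → ι →₀ ℤ, (∀ η, Function.Injective (G η)) ∧
        ∀ g, Function.Injective g → ∃ η, G η = g := by
    refine ⟨{g : ℕ → ι →₀ ℤ // Function.Injective g}, (Cardinal.mk_subtype_le _).trans ?_,
      Subtype.val, fun η => η.2, fun g hg => ⟨⟨g, hg⟩, rfl⟩⟩
    simp [hι, max_eq_left Cardinal.aleph0_le_continuum]
  -- A well-order of least possible type, so that proper initial segments have smaller cardinality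
  -- than `J`.
  obtain ⟨_, _, hord⟩ := Cardinal.exists_ord_eq_type_lt J
  have hIio : ∀ η : J, Cardinal.mk (Iio η) < Cardinal.continuum := fun η =>
    (Cardinal.mk_Iio_lt η hord).trans_le hJ
  obtain ⟨h, hh, hind⟩ := exists_independent_reindexing hU.free hIio G hG
  obtain ⟨m, hm, hsupp⟩ := exists_fresh_index hι hIio fun η a => G η (h η a)
  let V := {v : ι → UnitAddCircle // ∀ η : J,
    Tendsto (fun a => Finsupp.linearCombination ℤ v (G η (h η a))) U (nhds (v (m η)))}
  let Ψ : (ι →₀ ℤ) →+ (V → UnitAddCircle) :=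
    AddMonoidHom.pi fun v => (Finsupp.linearCombination ℤ v.1).toAddMonoidHom
  have hΨ : Function.Injective Ψ := by
    rw [injective_iff_map_eq_zero]
    intro c hc
    by_contra hne
    obtain ⟨v, hv, hlim⟩ := hU.exists_character hind hm hsupp hne
    exact hv (congrFun hc ⟨v, hlim⟩)
  let τ : TopologicalSpace (ι →₀ ℤ) := TopologicalSpace.induced Ψ inferInstance
  refine ⟨τ, topologicalAddGroup_induced Ψ,
    T2Space.of_injective_continuous hΨ continuous_induced_dom, fun g hg => ?_⟩
  obtain ⟨η, rfl⟩ := hGsurj g hg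
  refine ⟨h η, hh η, m η, ?_⟩
  rw [nhds_induced, tendsto_comap_iff, tendsto_pi_nhds]
  intro v
  have h1 : Ψ (Finsupp.single (m η) 1) v = v.1 (m η) := by
    change Finsupp.linearCombination ℤ v.1 _ = _
    simp
  rw [h1]
  exact v.2 η

/-- A sequence of finite range is constant on a set of `U`. Otherwise it has an injective subfamily
`x ∘ p`; since `p ∘ h` is injective, it tends to infinity along the free `U`, so the limit of `x ∘ p
∘ h` is a cluster point of `x`. -/
theorem isCountablyCompact_of_tendsto_reindexing {X : Type*} [TopologicalSpace X]
    {U : Ultrafilter ℕ} (hU : (U : Filter ℕ) ≤ cofinite) {A : Set X}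
    (hA : ∀ g : ℕ → X, Function.Injective g → ∃ h : ℕ → ℕ, Function.Injective h ∧ ∃ x ∈ A,
      Tendsto (fun a => g (h a)) U (nhds x)) : IsCountablyCompact A := by
  classical
  rw [isCountablyCompact_iff_seq_clusterPt]
  intro x hx
  have hUtop : (U : Filter ℕ) ≤ atTop := hU.trans Nat.cofinite_eq_atTop.le
  by_cases hfin : (range x).Finite
  · have hcover : (⋃ y ∈ range x, x ⁻¹' {y}) ∈ U := by
      have : (⋃ y ∈ range x, x ⁻¹' {y}) = univ := by ext; simp
      rw [this]; exact univ_mem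
    obtain ⟨y, -, hy⟩ := (Ultrafilter.finite_biUnion_mem_iff hfin).1 hcover
    obtain ⟨n, hn, hny⟩ := U.nonempty_of_mem (inter_mem (hUtop hx) hy)
    have hny : x n = y := hny
    refine ⟨y, hny ▸ hn, ?_⟩
    have hlim : Tendsto x U (nhds y) :=
      tendsto_const_nhds.congr' (mem_of_superset hy fun k hk => Eq.symm hk)
    exact hlim.mapClusterPt.of_comp (φ := id) hUtop
  · let e := Set.Infinite.natEmbedding _ hfin
    choose p hp using fun n => (e n).2
    have hxp : Function.Injective fun n => x (p n) := by
      intro k n hkn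
      have hkn : x (p k) = x (p n) := hkn
      rw [hp, hp] at hkn
      exact e.injective (Subtype.ext hkn)
    obtain ⟨h, hh, y, hy, hlim⟩ := hA _ hxp
    have hpinj : Function.Injective p := fun k n hkn => hxp (congrArg x hkn)
    have hph : Tendsto (fun a => p (h a)) U atTop := by
      rw [← Nat.cofinite_eq_atTop]
      exact (hpinj.comp hh).tendsto_cofinite.mono_left hU
    exact ⟨y, hy, hlim.mapClusterPt.of_comp hph⟩

/-- The obstruction to being a topological group is already algebraic: a group structure with this
multiplication has the same identity, and the inverse of a generator would have a coordinate `-1`.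
-/
theorem isWallaceSemigroup_natFinsupp {ι : Type*} [Nonempty ι] [TopologicalSpace (ι →₀ ℤ)]
    [IsTopologicalAddGroup (ι →₀ ℤ)] [T2Space (ι →₀ ℤ)]
    (hcc : IsCountablyCompact (natFinsupp ι : Set (ι →₀ ℤ))) :
    IsWallaceSemigroup (Multiplicative (natFinsupp ι)) where
  nonempty := inferInstance
  t2 := inferInstanceAs (T2Space (natFinsupp ι))
  continuousMul := inferInstance
  countablyCompact := isCountablyCompact_iff_countablyCompactSpace.1 hcc
  cancel := inferInstance
  not_topologicalGroup := by
    rintro ⟨G, hG, -⟩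
    obtain ⟨i⟩ := ‹Nonempty ι›
    have hmul : ∀ x y : Multiplicative (natFinsupp ι), G.mul x y = x * y := fun x y =>
      congrArg (fun S : Semigroup (Multiplicative (natFinsupp ι)) => S.mul x y) hG
    have hone : G.one = (1 : Multiplicative (natFinsupp ι)) := by
      have h1 : G.mul G.one 1 = 1 := G.one_mul 1
      rwa [hmul, mul_one] at h1
    let e : natFinsupp ι := ⟨Finsupp.single i 1, fun j => by
      classical
      rw [Finsupp.single_apply]; split_ifs <;> simp⟩
    have h2 : G.mul (G.inv (Multiplicative.ofAdd e)) (Multiplicative.ofAdd e) = G.one :=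
      G.inv_mul_cancel _
    rw [hmul, hone] at h2
    let y : natFinsupp ι := Multiplicative.toAdd (G.inv (Multiplicative.ofAdd e))
    have h3 : y + e = 0 := h2
    have h4 : (y : ι →₀ ℤ) i + 1 = 0 := by
      have := DFunLike.congr_fun (congrArg Subtype.val h3) i
      simpa [e] using this
    have h5 : 0 ≤ (y : ι →₀ ℤ) i := y.2 i
    omega

theorem IsSelective.exists_countablyCompact_topology {U : Ultrafilter ℕ} (hU : IsSelective U)
    {ι : Type*} (hι : Cardinal.mk ι = Cardinal.continuum) :
    ∃ _ : TopologicalSpace (ι →₀ ℤ),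
      IsTopologicalAddGroup (ι →₀ ℤ) ∧ T2Space (ι →₀ ℤ) ∧ CountablyCompactSpace (ι →₀ ℤ) ∧
        IsWallaceSemigroup (Multiplicative (natFinsupp ι)) := by
  classical
  have : Nonempty ι := Cardinal.mk_ne_zero_iff.1 (by rw [hι]; exact Cardinal.continuum_ne_zero)
  obtain ⟨τ, hgroup, ht2, hlim⟩ := hU.exists_addGroup_topology hι
  -- Stated for any set containing the generators, so as to cover both the whole group and the cone.
  have hcc : ∀ A : Set (ι →₀ ℤ), (∀ i, Finsupp.single i 1 ∈ A) → IsCountablyCompact A := by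
    intro A hA
    refine isCountablyCompact_of_tendsto_reindexing hU.free fun g hg => ?_
    obtain ⟨h, hh, i, hi⟩ := hlim g hg
    exact ⟨h, hh, _, hA i, hi⟩
  refine ⟨τ, hgroup, ht2, ⟨hcc _ fun _ => mem_univ _⟩,
    isWallaceSemigroup_natFinsupp (hcc _ fun i j => ?_)⟩
  rw [Finsupp.single_apply]
  split_ifs <;> simp

theorem mainTheorem2 (hsel : ∃ U : Ultrafilter ℕ, IsSelective U) :
    (∃ (S : Type) (_ : Semigroup S) (_ : TopologicalSpace S), IsWallaceSemigroup S) ∧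
    ∀ ι : Type*, Cardinal.mk ι = Cardinal.continuum →
      ∃ _ : TopologicalSpace (ι →₀ ℤ),
        IsTopologicalAddGroup (ι →₀ ℤ) ∧ T2Space (ι →₀ ℤ) ∧ CountablyCompactSpace (ι →₀ ℤ) ∧
          IsWallaceSemigroup (Multiplicative (natFinsupp ι)) := by
  obtain ⟨U, hU⟩ := hsel
  refine ⟨?_, fun ι hι => hU.exists_countablyCompact_topology hι⟩
  obtain ⟨τ, -, -, -, h⟩ := hU.exists_countablyCompact_topology Cardinal.mk_real
  exact ⟨_, _, _, h⟩
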